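/- Let $K$ be a field, let $n>m\geq 2$ and $t\geq 1$ be integers, and let $S=K[x_1,\ldots,x_n]$ and $S'=K[x_1,\ldots,x_{n-1}]\subset S$. Let $$J=(x_1x_2\cdots x_m,\ x_2\cdots x_{m+1},\ \ldots,\ x_{n-m+1}\cdots x_n,\ x_{n-m+2}\cdots x_nx_1,\ \ldots,\ x_nx_1\cdots x_{m-1})\subset S$$ be the $m$-path ideal of the cycle graph on $n$ vertices, let $$I=(x_1\cdots x_m,\ x_2\cdots x_{m+1},\ \ldots,\ x_{n-m}\cdots x_{n-1})\subset S'$$ be the $m$-path ideal of the path graph on $n-1$ vertices, and let $J'=(J:x_n)\cap S'$. For a proper monomial ideal $L$ of a polynomial ring $R$ in finitely many variables over $K$, let $\operatorname{depth}(R/L)$ be the maximal length of an $R/L$-regular sequence contained in the ideal generated by the variables. A Stanley decomposition of $R/L$ is a decomposition $\mathcal D:\ R/L=\bigoplus_{i=1}^r u_iK[Z_i]$ as a direct sum of $K$-vector spaces, where each $u_i$ is a monomial, each $Z_i$ is a set of variables, and each $u_iK[Z_i]\subset R/L$ is a free $K[Z_i]$-module. The Stanley depth $\operatorname{sdepth}(R/L)$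 is the maximum, over all such $\mathcal D$, of $\min_i|Z_i|$. For $1\leq k\leq t$ put $$d_k=\operatorname{depth}\bigl(S'/I^{t+1-k}J'^{\,k-1}\bigr),\qquad s_k=\operatorname{sdepth}\bigl(S'/I^{t+1-k}J'^{\,k-1}\bigr).$$ Then for all $1\leq k\leq t$: 1. $d_k\geq \operatorname{depth}(S/(J^t:x_n^{k-1}))-1$. 2. If $\operatorname{depth}(S/(J^t:x_n^{k}))>\operatorname{depth}(S/(J^t:x_n^{k-1}))$, then $d_k=\operatorname{depth}(S/(J^t:x_n^{k-1}))$. 3. If $\operatorname{sdepth}(S/(J^t:x_n^{k}))>\operatorname{sdepth}(S/(J^t:x_n^{k-1}))$, then $s_k\leq \operatorname{sdepth}(S/(J^t:x_n^{k-1}))$. -/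

import Mathlib

open MvPolynomial

/-- The depth of `M` with respect to the ideal `I`: the supremum of the lengths of the `M`-regular
sequences with entries in `I`. For a nonzero finitely generated graded module `M` over a polynomial
ring over a field and `I` the ideal generated by the variables, this is the usual depth of `M`. -/
noncomputable def gradedDepth {R : Type*} [CommRing R] (I : Ideal R)
    (M : Type*) [AddCommGroup M] [Module R M] : ℕ∞ :=
  ⨆ (rs : List R) (_ : RingTheory.Sequence.IsRegular M rs ∧ ∀ r ∈ rs, r ∈ I), (rs.length : ℕ∞)

/-- `depth (S / L)` for an ideal `L` of the polynomial ring `S = K[x_i : i ∈ σ]`. -/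
noncomputable def quotDepth {σ K : Type*} [Field K] (L : Ideal (MvPolynomial σ K)) : ℕ∞ :=
  gradedDepth (idealOfVars σ K) (MvPolynomial σ K ⧸ L)

/-- The `K`-subspace `u K[Z]` of `S / L`, where `u` is the monomial with exponent vector `u` and
`Z` is a set of variables. -/
noncomputable def stanleySpace {σ K : Type*} [Field K] (L : Ideal (MvPolynomial σ K))
    (u : σ →₀ ℕ) (Z : Finset σ) : Submodule K (MvPolynomial σ K ⧸ L) :=
  ((Subalgebra.toSubmodule (supported K (Z : Set σ))).map
    (LinearMap.mulLeft K (monomial u (1 : K)))).map (Ideal.Quotient.mkₐ K L).toLinearMap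

/-- A Stanley decomposition of `S / L`: a finite family of monomials `u_i` and sets of variables
`Z_i` such that each `u_i K[Z_i] ⊆ S / L` is a free `K[Z_i]`-module (that is, `f ↦ u_i f` is
injective from `K[Z_i]` to `S / L`) and `S / L` is the direct sum of the `u_i K[Z_i]`. -/
structure StanleyDecomposition {σ K : Type*} [Field K] (L : Ideal (MvPolynomial σ K)) where
  r : ℕ
  u : Fin r → (σ →₀ ℕ)
  Z : Fin r → Finset σ
  free : ∀ i, ∀ f ∈ supported K (Z i : Set σ), monomial (u i) (1 : K) * f ∈ L → f = 0
  isInternal : DirectSum.IsInternal fun i => stanleySpace L (u i) (Z i)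

/-- The Stanley depth of a Stanley decomposition: the minimum of the `|Z_i|`. -/
noncomputable def StanleyDecomposition.sdepth {σ K : Type*} [Field K]
    {L : Ideal (MvPolynomial σ K)} (D : StanleyDecomposition L) : ℕ∞ :=
  ⨅ i, ((D.Z i).card : ℕ∞)

/-- The Stanley depth `sdepth (S / L)`. -/
noncomputable def quotSdepth {σ K : Type*} [Field K] (L : Ideal (MvPolynomial σ K)) : ℕ∞ :=
  ⨆ D : StanleyDecomposition L, D.sdepth

/-- The `m`-path ideal `I_{n,m} = (x_1 ⋯ x_m, x_2 ⋯ x_{m+1}, …, x_{n-m+1} ⋯ x_n)` of the path graph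
on `n` vertices; the variable `x_i` is `X ⟨i - 1, _⟩`. -/
noncomputable def pathIdeal (K : Type*) [Field K] (n m : ℕ) : Ideal (MvPolynomial (Fin n) K) :=
  Ideal.span {p | ∃ (i : ℕ) (h : i + m ≤ n), p = ∏ j : Fin m, X ⟨i + j, by omega⟩}

/-- The `m`-path ideal `J_{n,m}` of the cycle graph on `n` vertices: it is generated by the products
of `m` cyclically consecutive variables. -/
noncomputable def cyclePathIdeal (K : Type*) [Field K] (n m : ℕ) :
    Ideal (MvPolynomial (Fin n) K) :=
  Ideal.span {p | ∃ i : Fin n, p = ∏ j : Fin m, X ⟨(i + j) % n, Nat.mod_lt _ i.pos⟩}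

/-- The variable `x_n` of `S = K[x_1, …, x_n]`. -/
noncomputable def lastVar (K : Type*) [Field K] (n : ℕ) (hn : 0 < n) : MvPolynomial (Fin n) K :=
  X ⟨n - 1, Nat.sub_lt hn Nat.one_pos⟩

/-- The ideal `J' = (J_{n,m} : x_n) ∩ S'` of `S' = K[x_1, …, x_{n-1}] ⊆ S`. -/
noncomputable def contractedColon (K : Type*) [Field K] (n m : ℕ) (hn : 0 < n) :
    Ideal (MvPolynomial (Fin (n - 1)) K) :=
  ((cyclePathIdeal K n m).colon {lastVar K n hn}).comap
    (rename (Fin.castLE (Nat.sub_le n 1)) :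
      MvPolynomial (Fin (n - 1)) K →ₐ[K] MvPolynomial (Fin n) K)

/-- The ideal `I^{t+1-k} J'^{k-1}` of `S'`, where `I = I_{n-1,m}`; it is used for `1 ≤ k ≤ t`. -/
noncomputable def mixedIdeal (K : Type*) [Field K] (n m : ℕ) (hn : 0 < n) (t k : ℕ) :
    Ideal (MvPolynomial (Fin (n - 1)) K) :=
  pathIdeal K (n - 1) m ^ (t + 1 - k) * contractedColon K n m hn ^ (k - 1)

/-- The ideal `(J_{n,m}^t : x_n^k)` of `S`. -/
noncomputable def colonIdeal (K : Type*) [Field K] (n m : ℕ) (hn : 0 < n) (t k : ℕ) :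
    Ideal (MvPolynomial (Fin n) K) :=
  (cyclePathIdeal K n m ^ t).colon {lastVar K n hn ^ k}

/-!
Write `x = x_n`. Sorting the generators of `J` by whether they involve `x` gives `J = I + x J'` with
`I ⊆ J'`. In degree `a` with respect to `x`, the ideal `J^t` is therefore `I^{t-a} J'^a` for
`a ≤ t` and `J'^t` for `a ≥ t`. Hence the ideals `L = (J^t : x^{k-1})` are homogeneous in `x`, with
`L ∩ S' = I^{t+1-k} J'^{k-1}`, so that `S / (L, x) = S' / I^{t+1-k} J'^{k-1}`, and
`(L : x) = (J^t : x^k)`.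

* For every ideal `L` homogeneous in `x`, `depth S / L ≤ depth S' / (L ∩ S') + 1`: unless
  `depth S / L ≤ 1`, some `c ∈ S'` without constant term is regular on `S / L`, hence on
  `S' / (L ∩ S')`, and passing to the quotient by `c` lowers both depths by one. Such a `c` exists
  because an element of `S / L` killed by the variables of `S'` is divisible by every power of `x`
  as soon as `depth S / L ≥ 2`, hence zero.
* The equality of depths is the depth lemma for `0 → S / (L : x) → S / L → S / (L, x) → 0`, which
  follows from Rees' description of depth by the vanishing of `Ext`.
* As a vector space `S / L` is the direct sum of `x S / (L : x)` and `S' / (L ∩ S')`, so Stanley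
  decompositions of the two summands combine to one of `S / L`, and
  `sdepth S / L ≥ min (sdepth S / (L : x)) (sdepth S' / (L ∩ S'))`.
-/

section Depth

open CategoryTheory CategoryTheory.Abelian RingTheory.Sequence
open scoped Pointwise

universe u v

variable {R : Type u} [CommRing R] {I : Ideal R}

theorem gradedDepth_congr {R' M M' : Type*} [CommRing R'] [AddCommGroup M] [Module R M]
    [AddCommGroup M'] [Module R' M'] {ψ : R →+* R'} (hψ : Function.Surjective ψ) (e : M ≃+ M')
    (he : ∀ (r : R) (x : M), e (r • x) = ψ r • e x) (I : Ideal R) :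
    gradedDepth I M = gradedDepth (I.map ψ) M' := by
  have isRegular_map (rs : List R) : IsRegular M rs ↔ IsRegular M' (rs.map ψ) :=
    AddEquiv.isRegular_congr (e := e) <| List.forall₂_map_right_iff.2 <|
      List.forall₂_same.2 fun r _ x => he r x
  refine le_antisymm (iSup₂_le fun rs hrs => ?_) (iSup₂_le fun rs' hrs' => ?_)
  · refine le_iSup₂_of_le (rs.map ψ) ⟨(isRegular_map rs).1 hrs.1, ?_⟩ (by simp)
    simpa using fun r hr => Ideal.mem_map_of_mem ψ (hrs.2 r hr)
  · obtain ⟨rs, hrs, rfl⟩ : ∃ rs : List R, (∀ r ∈ rs, r ∈ I) ∧ rs.map ψ = rs' := by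
      choose! g hg using fun r' (hr' : r' ∈ rs') =>
        (Ideal.mem_map_iff_of_surjective ψ hψ).1 (hrs'.2 r' hr')
      refine ⟨rs'.map g, by simpa using fun r' hr' => (hg r' hr').1, ?_⟩
      rw [List.map_map]
      exact (List.map_congr_left fun r' hr' => (hg r' hr').2).trans (List.map_id rs')
    exact le_iSup₂_of_le rs ⟨(isRegular_map rs).2 hrs'.1, hrs⟩ (by simp)

theorem gradedDepth_congr_linearEquiv {M M' : Type*} [AddCommGroup M] [Module R M]
    [AddCommGroup M'] [Module R M'] (I : Ideal R) (e : M ≃ₗ[R] M') :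
    gradedDepth I M = gradedDepth I M' := by
  simpa only [Ideal.map_id] using
    gradedDepth_congr (ψ := RingHom.id R) Function.surjective_id e.toAddEquiv (map_smul e) I

theorem gradedDepth_quotient_comap {R' : Type*} [CommRing R'] {ψ : R →+* R'}
    (hψ : Function.Surjective ψ) (I : Ideal R) (L : Ideal R') :
    gradedDepth I (R ⧸ L.comap ψ) = gradedDepth (I.map ψ) (R' ⧸ L) := by
  let e := RingEquiv.ofBijective (Ideal.quotientMap L ψ le_rfl)
    ⟨Ideal.quotientMap_injective, Ideal.quotientMap_surjective hψ⟩
  refine gradedDepth_congr hψ e.toAddEquiv (fun r x => ?_) I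
  change e (r • x) = ψ r • e x
  rw [Algebra.smul_def, Algebra.smul_def, map_mul]
  rfl

theorem smul_top_quotient_lt_top {L : Ideal R} (hI : I ≠ ⊤) (hL : L ≤ I) :
    I • (⊤ : Submodule R (R ⧸ L)) < ⊤ := by
  refine lt_top_iff_ne_top.2 fun h => hI ?_
  have comap_eq := Submodule.comap_smul_top_of_surjective I _ (Submodule.mkQ_surjective L)
  rw [h, Submodule.comap_top, Submodule.ker_mkQ, smul_eq_mul, Ideal.mul_top, sup_eq_left.2 hL]
    at comap_eq
  exact comap_eq.symm

theorem smul_top_lt_top_of_surjective {M N : Type*} [AddCommGroup M] [Module R M] [AddCommGroup N]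
    [Module R N] {g : M →ₗ[R] N} (hg : Function.Surjective g)
    (hN : I • (⊤ : Submodule R N) < ⊤) : I • (⊤ : Submodule R M) < ⊤ := by
  refine lt_top_iff_ne_top.2 fun h => hN.ne ?_
  simpa [Submodule.map_smul'', LinearMap.range_eq_top.2 hg] using congrArg (Submodule.map g) h

variable {M : Type v} [AddCommGroup M] [Module R M]

theorem natCast_le_gradedDepth_iff_exists [Nontrivial M] {p : ℕ} :
    (p : ℕ∞) ≤ gradedDepth I M ↔
      ∃ rs : List R, (IsRegular M rs ∧ ∀ r ∈ rs, r ∈ I) ∧ p ≤ rs.length := by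
  refine ⟨fun hp => ?_, fun ⟨rs, hrs, hlen⟩ => le_iSup₂_of_le rs hrs (by exact_mod_cast hlen)⟩
  obtain - | p := p
  · exact ⟨[], ⟨IsRegular.nil R M, by simp⟩, le_rfl⟩
  · have : (p : ℕ∞) < gradedDepth I M := lt_of_lt_of_le (by exact_mod_cast p.lt_succ_self) hp
    simpa only [gradedDepth, lt_iSup_iff, Nat.cast_lt, exists_prop, Nat.succ_le_iff] using this

theorem natCast_le_gradedDepth_iff [Small.{v} R] [IsNoetherianRing R] [Module.Finite R M]
    (hM : I • (⊤ : Submodule R M) < ⊤) {p : ℕ} :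
    (p : ℕ∞) ≤ gradedDepth I M ↔ ∀ i < p, Subsingleton
      (Ext (ModuleCat.of R (Shrink.{v} (R ⧸ I))) (ModuleCat.of R M) i) := by
  have : Nontrivial M := (Submodule.nontrivial_iff R).1 (nontrivial_of_lt _ _ hM)
  have rees (q : ℕ) := (ModuleCat.exists_isRegular_tfae I q (.of R M) hM).out 1 3
  rw [natCast_le_gradedDepth_iff_exists]
  constructor
  · rintro ⟨rs, hrs, hlen⟩ i hi
    exact (rees rs.length).2 ⟨rs, rfl, hrs.2, hrs.1⟩ i (hi.trans_le hlen)
  · intro h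
    obtain ⟨rs, hlen, hrs, hreg⟩ := (rees p).1 h
    exact ⟨rs, ⟨hreg, hrs⟩, hlen.ge⟩

section ShortExact

variable {M₁ M₂ M₃ : Type v} [AddCommGroup M₁] [Module R M₁] [AddCommGroup M₂] [Module R M₂]
  [AddCommGroup M₃] [Module R M₃] {f : M₁ →ₗ[R] M₂} {g : M₂ →ₗ[R] M₃}

variable [Small.{v} R] [IsNoetherianRing R] [Module.Finite R M₁] [Module.Finite R M₂]
  [Module.Finite R M₃]

theorem min_gradedDepth_le_of_exact
    (hf : Function.Injective f) (hfg : Function.Exact f g) (hg : Function.Surjective g)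
    (h₁ : I • (⊤ : Submodule R M₁) < ⊤)
    (h₃ : I • (⊤ : Submodule R M₃) < ⊤) :
    min (gradedDepth I M₁) (gradedDepth I M₃) ≤ gradedDepth I M₂ := by
  have exact := ModuleCat.shortComplex_shortExact
    (ShortComplex.moduleCatMk f g hfg.linearMap_comp_eq_zero) hfg hf hg
  refine ENat.forall_natCast_le_iff_le.1 fun p hp => ?_
  rw [le_min_iff, natCast_le_gradedDepth_iff h₁, natCast_le_gradedDepth_iff h₃] at hp
  rw [natCast_le_gradedDepth_iff (smul_top_lt_top_of_surjective hg h₃)]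
  intro i hi
  have zero₁ := AddCommGrpCat.isZero_of_iff_subsingleton.2 (hp.1 i hi)
  have zero₃ := AddCommGrpCat.isZero_of_iff_subsingleton.2 (hp.2 i hi)
  exact AddCommGrpCat.subsingleton_of_isZero <| ShortComplex.Exact.isZero_of_both_zeros
    (Ext.covariant_sequence_exact₂' _ exact i)
    (zero₁.eq_zero_of_src _) (zero₃.eq_zero_of_tgt _)

theorem min_gradedDepth_le_add_one_of_exact
    (hf : Function.Injective f) (hfg : Function.Exact f g) (hg : Function.Surjective g)
    (h₁ : I • (⊤ : Submodule R M₁) < ⊤)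
    (h₃ : I • (⊤ : Submodule R M₃) < ⊤) :
    min (gradedDepth I M₁) (gradedDepth I M₂ + 1) ≤ gradedDepth I M₃ + 1 := by
  have exact := ModuleCat.shortComplex_shortExact
    (ShortComplex.moduleCatMk f g hfg.linearMap_comp_eq_zero) hfg hf hg
  refine ENat.forall_natCast_le_iff_le.1 fun p hp => ?_
  obtain - | p := p
  · simp
  push_cast at hp ⊢
  rw [le_min_iff, ENat.add_le_add_iff_right (by simp), ← Nat.cast_add_one,
    natCast_le_gradedDepth_iff h₁,
    natCast_le_gradedDepth_iff (smul_top_lt_top_of_surjective hg h₃)] at hp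
  rw [ENat.add_le_add_iff_right (by simp), natCast_le_gradedDepth_iff h₃]
  intro i hi
  have zero₁ := AddCommGrpCat.isZero_of_iff_subsingleton.2 (hp.1 (i + 1) (by lia))
  have zero₂ := AddCommGrpCat.isZero_of_iff_subsingleton.2 (hp.2 i hi)
  exact AddCommGrpCat.subsingleton_of_isZero <| ShortComplex.Exact.isZero_of_both_zeros
    (Ext.covariant_sequence_exact₃' _ exact i (i + 1) rfl)
    (zero₂.eq_zero_of_src _) (zero₁.eq_zero_of_tgt _)

end ShortExact

theorem smul_top_quotSMulTop_lt_top {f : R} (hfI : f ∈ I) (hM : I • (⊤ : Submodule R M) < ⊤) :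
    I • (⊤ : Submodule R (QuotSMulTop f M)) < ⊤ := by
  refine lt_top_iff_ne_top.2 fun h => hM.ne ?_
  have comap_eq := Submodule.comap_smul_top_of_surjective I _
    (Submodule.mkQ_surjective (f • (⊤ : Submodule R M)))
  rw [h, Submodule.comap_top, Submodule.ker_mkQ, ← Submodule.ideal_span_singleton_smul,
    sup_eq_left.2 (Submodule.smul_mono_left ((Ideal.span_singleton_le_iff_mem I).2 hfI))]
    at comap_eq
  exact comap_eq.symm

theorem gradedDepth_quotSMulTop_add_one [Small.{v} R] [IsNoetherianRing R] [Module.Finite R M]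
    (hM : I • (⊤ : Submodule R M) < ⊤) {f : R} (hfI : f ∈ I) (hf : IsSMulRegular M f) :
    gradedDepth I (QuotSMulTop f M) + 1 = gradedDepth I M := by
  have hquot := smul_top_quotSMulTop_lt_top hfI hM
  have : Nontrivial (QuotSMulTop f M) :=
    (Submodule.nontrivial_iff R).1 (nontrivial_of_lt _ _ hquot)
  have : Nontrivial M := (Submodule.nontrivial_iff R).1 (nontrivial_of_lt _ _ hM)
  apply le_antisymm
  · refine ENat.forall_natCast_le_iff_le.1 fun p hp => ?_
    obtain - | p := p
    · simp
    rw [Nat.cast_add_one, ENat.add_le_add_iff_right (by simp),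
      natCast_le_gradedDepth_iff_exists] at hp
    obtain ⟨rs, ⟨hreg, hrs⟩, hlen⟩ := hp
    exact natCast_le_gradedDepth_iff_exists.2
      ⟨f :: rs, ⟨hreg.cons hf, List.forall_mem_cons.2 ⟨hfI, hrs⟩⟩, by simpa using hlen⟩
  · simpa only [min_eq_left le_self_add] using
      min_gradedDepth_le_add_one_of_exact (f := LinearMap.lsmul R M f) hf
        (LinearMap.exact_lsmul_mkQ_smul_top M f) (Submodule.mkQ_surjective _) hM hquot

theorem gradedDepth_quotient_sup_span_add_one [IsNoetherianRing R] {L : Ideal R} (hI : I ≠ ⊤)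
    (hL : L ≤ I) {f : R} (hfI : f ∈ I) (hf : IsSMulRegular (R ⧸ L) f) :
    gradedDepth I (R ⧸ L ⊔ Ideal.span {f}) + 1 = gradedDepth I (R ⧸ L) := by
  have smul_top : f • (⊤ : Submodule R (R ⧸ L)) =
      Submodule.map L.mkQ (Ideal.span {f}) := by
    rw [← Submodule.ideal_span_singleton_smul, ← L.range_mkQ, ← Submodule.map_top,
      ← Submodule.map_smul'', smul_eq_mul, Ideal.mul_top]
  let e : QuotSMulTop f (R ⧸ L) ≃ₗ[R] R ⧸ L ⊔ Ideal.span {f} :=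
    (Submodule.quotEquivOfEq _ _ smul_top).trans (Submodule.quotientQuotientEquivQuotientSup _ _)
  have hquot := smul_top_quotient_lt_top hI hL
  rw [← gradedDepth_congr_linearEquiv I e]
  exact gradedDepth_quotSMulTop_add_one hquot hfI hf

/-- Multiplication by `x`, as an injection of `R ⧸ (L : x)` into `R ⧸ L`. -/
noncomputable def mulColon (L : Ideal R) (x : R) : (R ⧸ L.colon {x}) →ₗ[R] R ⧸ L :=
  Submodule.mapQ _ L (LinearMap.mulLeft R x) fun y hy => by
    simpa [mul_comm] using Submodule.mem_colon_singleton.1 hy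

theorem mulColon_injective (L : Ideal R) (x : R) : Function.Injective (mulColon L x) := by
  have comap_eq : Submodule.comap (LinearMap.mulLeft R x) L = L.colon {x} := by
    ext y
    simp [mul_comm, Submodule.mem_colon_singleton]
  rw [← LinearMap.ker_eq_bot, mulColon, Submodule.ker_mapQ, comap_eq, Submodule.mkQ_map_self]

theorem exact_mulColon_factor (L : Ideal R) (x : R) :
    Function.Exact (mulColon L x) (Submodule.factor (le_sup_left : L ≤ L ⊔ Ideal.span {x})) := by
  have range_eq : (LinearMap.mulLeft R x).range = Ideal.span {x} := by
    ext y
    simp [Ideal.mem_span_singleton', mul_comm]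
  rw [LinearMap.exact_iff, mulColon, Submodule.range_mapQ, Submodule.factor, Submodule.ker_mapQ,
    range_eq, Submodule.comap_id, Submodule.map_sup, Submodule.mkQ_map_self, bot_sup_eq]

theorem gradedDepth_quotient_sup_span_eq_of_lt [IsNoetherianRing R] {L : Ideal R} {x : R}
    (hI : I ≠ ⊤) (hcolon : L.colon {x} ≤ I) (hx : x ∈ I)
    (hlt : gradedDepth I (R ⧸ L) < gradedDepth I (R ⧸ L.colon {x})) :
    gradedDepth I (R ⧸ L ⊔ Ideal.span {x}) = gradedDepth I (R ⧸ L) := by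
  have hL : L ≤ I := le_trans (fun y hy => Submodule.mem_colon_singleton.2
    (L.mul_mem_right x hy)) hcolon
  have lower := min_gradedDepth_le_of_exact (mulColon_injective L x) (exact_mulColon_factor L x)
    (Submodule.factor_surjective _) (smul_top_quotient_lt_top hI hcolon)
    (smul_top_quotient_lt_top hI (sup_le hL ((Ideal.span_singleton_le_iff_mem I).2 hx)))
  have upper := min_gradedDepth_le_add_one_of_exact (mulColon_injective L x)
    (exact_mulColon_factor L x) (Submodule.factor_surjective _) (smul_top_quotient_lt_top hI hcolon)
    (smul_top_quotient_lt_top hI (sup_le hL ((Ideal.span_singleton_le_iff_mem I).2 hx)))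
  refine le_antisymm ((min_le_iff.1 lower).resolve_left hlt.not_ge) ?_
  rwa [min_eq_right (Order.add_one_le_of_lt hlt), ENat.add_le_add_iff_right (by simp)] at upper

theorem exists_isSMulRegular_of_forall_smul_eq_zero {A : Type*} [CommRing A] [IsNoetherianRing R]
    [Module.Finite R M] (φ : A →+* R) {𝔞 : Ideal A}
    (h : ∀ z : M, (∀ r ∈ 𝔞.map φ, r • z = 0) → z = 0) : ∃ c ∈ 𝔞, IsSMulRegular M (φ c) := by
  by_contra! hnot
  have cover : (𝔞 : Set A) ⊆ ⋃ P ∈ associatedPrimes R M, P.comap φ := by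
    intro c hc
    have := hnot c hc
    rw [isSMulRegular_iff_right_eq_zero_of_smul] at this
    push Not at this
    obtain ⟨z, hz, hz0⟩ := this
    have : φ c ∈ ⋃ P ∈ associatedPrimes R M, (P : Set R) := by
      rw [biUnion_associatedPrimes_eq_zero_divisors]
      exact ⟨z, hz0, hz⟩
    simpa using this
  obtain ⟨P, hP, hle⟩ := (Ideal.subset_union_prime_finite (associatedPrimes.finite R M) ⊥ ⊥
    fun P hP _ _ => (IsAssociatedPrime.isPrime hP).comap φ).1 cover
  obtain ⟨hprime, z, rfl⟩ := isAssociatedPrime_iff.1 hP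
  have hz := h z fun r hr => by
    simpa [Submodule.mem_colon_singleton] using Ideal.map_le_iff_le_comap.2 hle hr
  exact hprime.ne_top (by simp [hz])

theorem exists_eq_smul_of_two_le_gradedDepth {𝔞 : Ideal R} {x : R}
    (h : 2 ≤ gradedDepth (𝔞 ⊔ Ideal.span {x}) M) {z : M} (hz : ∀ a ∈ 𝔞, a • z = 0) :
    ∃ w : M, (∀ a ∈ 𝔞, a • w = 0) ∧ z = x • w := by
  cases subsingleton_or_nontrivial M
  · exact ⟨z, hz, Subsingleton.elim _ _⟩
  obtain ⟨_ | ⟨y, _ | ⟨s, rs⟩⟩, ⟨hreg, hmem⟩, hlen⟩ := natCast_le_gradedDepth_iff_exists.1 h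
  · simp at hlen
  · simp at hlen
  obtain ⟨hy, hs, -⟩ := (isRegular_cons_iff M y _).1 hreg |>.imp_right (isRegular_cons_iff _ s rs).1
  rw [isSMulRegular_iff_right_eq_zero_of_smul] at hy hs
  obtain ⟨g, y', hy', rfl⟩ := Ideal.mem_span_singleton_sup.1 (sup_comm 𝔞 _ ▸ hmem y (by simp))
  obtain ⟨v, s', hs', rfl⟩ := Ideal.mem_span_singleton_sup.1 (sup_comm 𝔞 _ ▸ hmem s (by simp))
  -- On elements killed by `𝔞`, the regular sequence `y, s` acts as `g x, v x`.
  set y := g * x + y'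
  have y_smul : y • z = x • g • z := by
    rw [add_smul, hz y' hy', add_zero, mul_comm, mul_smul]
  have s_smul : (v * x + s') • g • z = y • v • z := by
    rw [add_smul, smul_comm s', hz s' hs', smul_zero, add_zero, smul_comm y, y_smul, mul_smul]
  obtain ⟨w, hw⟩ : ∃ w, g • z = y • w := by
    have := hs (Submodule.mkQ _ (g • z)) <| by
      rw [← map_smul, s_smul, Submodule.mkQ_apply, Submodule.Quotient.mk_eq_zero]
      exact Submodule.smul_mem_pointwise_smul _ _ _ trivial
    rw [Submodule.mkQ_apply, Submodule.Quotient.mk_eq_zero] at this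
    obtain ⟨w, -, hw⟩ := this
    exact ⟨w, hw.symm⟩
  refine ⟨w, fun a ha => hy _ ?_, ?_⟩
  · rw [smul_comm, ← hw, smul_comm, hz a ha, smul_zero]
  · rw [← sub_eq_zero]
    apply hy
    rw [smul_sub, y_smul, hw, smul_comm, sub_self]

end Depth

section DegreeHomogeneous

open scoped Polynomial

variable {A : Type*} [CommRing A] {I : Ideal A} {P : Ideal A[X]}

/-- `P` is homogeneous for the grading of `A[X]` by degree. -/
def IsDegreeHomogeneous (P : Ideal A[X]) : Prop :=
  ∀ f ∈ P, ∀ a, Polynomial.monomial a (f.coeff a) ∈ P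

theorem isDegreeHomogeneous_map_C (I : Ideal A) : IsDegreeHomogeneous (I.map Polynomial.C) := by
  intro f hf a
  rw [Ideal.mem_map_C_iff] at hf ⊢
  intro b
  rw [Polynomial.coeff_monomial]
  split_ifs
  exacts [hf a, I.zero_mem]

namespace IsDegreeHomogeneous

theorem sup_span_C (hP : IsDegreeHomogeneous P) (c : A) :
    IsDegreeHomogeneous (P ⊔ Ideal.span {Polynomial.C c}) := by
  intro f hf a
  rw [sup_comm, Ideal.mem_span_singleton_sup] at hf ⊢
  obtain ⟨w, l, hl, rfl⟩ := hf
  exact ⟨Polynomial.monomial a (w.coeff a), _, hP l hl a,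
    by simp [mul_comm, Polynomial.C_mul_monomial]⟩

theorem comap_C_sup_span (hP : IsDegreeHomogeneous P) (c : A) :
    (P ⊔ Ideal.span {Polynomial.C c}).comap Polynomial.C =
      P.comap Polynomial.C ⊔ Ideal.span {c} := by
  ext z
  simp only [Ideal.mem_comap, sup_comm _ (Ideal.span _), Ideal.mem_span_singleton_sup]
  constructor
  · rintro ⟨w, l, hl, hw⟩
    exact ⟨w.coeff 0, l.coeff 0, hP l hl 0, by simpa using congrArg (Polynomial.coeff · 0) hw⟩
  · rintro ⟨w, l, hl, rfl⟩
    exact ⟨Polynomial.C w, Polynomial.C l, hl, by simp⟩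

theorem sup_span_X (hP : IsDegreeHomogeneous P) :
    P ⊔ Ideal.span {Polynomial.X} = (P.comap Polynomial.C).comap Polynomial.constantCoeff := by
  ext z
  simp only [Ideal.mem_comap, sup_comm _ (Ideal.span _), Ideal.mem_span_singleton_sup]
  constructor
  · rintro ⟨w, l, hl, rfl⟩
    simpa using hP l hl 0
  · exact fun h => ⟨z.divX, _, h, by simp [Polynomial.divX_mul_X_add]⟩

theorem eq_zero_of_forall_eq_X_pow_smul (hP : IsDegreeHomogeneous P) {z : A[X] ⧸ P}
    (hz : ∀ n : ℕ, ∃ w, z = (Polynomial.X : A[X]) ^ n • w) : z = 0 := by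
  obtain ⟨f, rfl⟩ := Ideal.Quotient.mk_surjective z
  rw [Ideal.Quotient.eq_zero_iff_mem, f.as_sum_support]
  refine P.sum_mem fun a _ => ?_
  obtain ⟨w, hw⟩ := hz (a + 1)
  obtain ⟨g, rfl⟩ := Ideal.Quotient.mk_surjective w
  have hmem : f - Polynomial.X ^ (a + 1) * g ∈ P := by
    rwa [← Ideal.Quotient.eq, map_mul]
  simpa [Polynomial.coeff_X_pow_mul'] using hP _ hmem a

theorem eq_zero_of_forall_smul_eq_zero (hP : IsDegreeHomogeneous P)
    (hdepth : 2 ≤ gradedDepth (I.map Polynomial.C ⊔ Ideal.span {Polynomial.X}) (A[X] ⧸ P))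
    {z : A[X] ⧸ P} (hz : ∀ r ∈ I.map Polynomial.C, r • z = 0) : z = 0 := by
  have divide (n : ℕ) : ∃ w : A[X] ⧸ P,
      (∀ r ∈ I.map Polynomial.C, r • w = 0) ∧ z = (Polynomial.X : A[X]) ^ n • w := by
    induction n with
    | zero => exact ⟨z, hz, by simp⟩
    | succ n ih =>
      obtain ⟨w, hw, rfl⟩ := ih
      obtain ⟨w', hw', rfl⟩ := exists_eq_smul_of_two_le_gradedDepth hdepth hw
      exact ⟨w', hw', by rw [pow_succ, mul_smul]⟩
  exact hP.eq_zero_of_forall_eq_X_pow_smul fun n => (divide n).imp fun w hw => hw.2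

end IsDegreeHomogeneous

theorem map_C_sup_span_X (I : Ideal A) :
    I.map Polynomial.C ⊔ Ideal.span {Polynomial.X} = I.comap Polynomial.constantCoeff := by
  rw [(isDegreeHomogeneous_map_C I).sup_span_X]
  congr 1
  ext c
  rw [Ideal.mem_comap, Ideal.mem_map_C_iff]
  exact ⟨fun h => by simpa using h 0, fun h a => by
    rw [Polynomial.coeff_C]; split_ifs; exacts [h, I.zero_mem]⟩

theorem map_C_sup_span_X_ne_top (hI : I ≠ ⊤) :
    I.map Polynomial.C ⊔ Ideal.span {Polynomial.X} ≠ ⊤ := by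
  rw [map_C_sup_span_X]
  exact Ideal.comap_ne_top _ hI

namespace IsDegreeHomogeneous

theorem le_map_C_sup_span_X (hP : IsDegreeHomogeneous P) (hPI : P.comap Polynomial.C ≤ I) :
    P ≤ I.map Polynomial.C ⊔ Ideal.span {Polynomial.X} := by
  rw [map_C_sup_span_X]
  exact fun f hf => hPI (hP f hf 0)

theorem gradedDepth_sup_span_X (hP : IsDegreeHomogeneous P) (I : Ideal A) :
    gradedDepth (I.map Polynomial.C ⊔ Ideal.span {Polynomial.X})
        (A[X] ⧸ P ⊔ Ideal.span {Polynomial.X}) =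
      gradedDepth I (A ⧸ P.comap Polynomial.C) := by
  rw [hP.sup_span_X, gradedDepth_quotient_comap Polynomial.constantCoeff_surjective,
    map_C_sup_span_X, Ideal.map_comap_of_surjective _ Polynomial.constantCoeff_surjective]

theorem gradedDepth_le_gradedDepth_comap_add_one [IsNoetherianRing A] (hI : I ≠ ⊤)
    (hP : IsDegreeHomogeneous P) (hPI : P.comap Polynomial.C ≤ I) :
    gradedDepth (I.map Polynomial.C ⊔ Ideal.span {Polynomial.X}) (A[X] ⧸ P) ≤
      gradedDepth I (A ⧸ P.comap Polynomial.C) + 1 := by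
  refine ENat.forall_natCast_le_iff_le.1 fun p hp => ?_
  induction p generalizing P with
  | zero => simp
  | succ p ih =>
    obtain rfl | hp0 := eq_or_ne p 0
    · simp
    obtain ⟨c, hcI, hc⟩ := exists_isSMulRegular_of_forall_smul_eq_zero Polynomial.C fun z hz =>
      hP.eq_zero_of_forall_smul_eq_zero (le_trans (by norm_cast; lia) hp) hz
    have hc' : IsSMulRegular (A ⧸ P.comap Polynomial.C) c := by
      rw [isSMulRegular_quotient_iff_mem_of_smul_mem] at hc ⊢
      exact fun a ha => hc (Polynomial.C a) (by simpa using ha)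
    rw [← gradedDepth_quotient_sup_span_add_one (map_C_sup_span_X_ne_top hI)
      (hP.le_map_C_sup_span_X hPI) (Ideal.mem_sup_left (Ideal.mem_map_of_mem Polynomial.C hcI)) hc,
      Nat.cast_add_one, ENat.add_le_add_iff_right (by simp)] at hp
    rw [← gradedDepth_quotient_sup_span_add_one hI hPI hcI hc', ← hP.comap_C_sup_span,
      Nat.cast_add_one, ENat.add_le_add_iff_right (by simp)]
    refine ih (hP.sup_span_C c) ?_ hp
    rw [hP.comap_C_sup_span]
    exact sup_le hPI ((Ideal.span_singleton_le_iff_mem I).2 hcI)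

end IsDegreeHomogeneous

end DegreeHomogeneous

section LinearExtension

open scoped Polynomial

variable {A : Type*} [CommRing A] {I J : Ideal A}

theorem colon_pow_colon (I : Ideal A) (x : A) (k : ℕ) :
    (I.colon {x ^ k}).colon {x} = I.colon {x ^ (k + 1)} := by
  ext y
  simp only [Submodule.mem_colon_singleton, smul_eq_mul, mul_assoc, pow_succ']

theorem pow_mul_pow_le_pow_mul_pow (hIJ : I ≤ J) {a b c d : ℕ} (hca : c ≤ a)
    (h : c + d ≤ a + b) : I ^ a * J ^ b ≤ I ^ c * J ^ d := by
  obtain ⟨r, rfl⟩ := Nat.exists_eq_add_of_le hca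
  rw [pow_add, mul_assoc]
  refine Ideal.mul_mono_right ?_
  calc I ^ r * J ^ b ≤ J ^ r * J ^ b := Ideal.mul_mono_left (Ideal.pow_right_mono hIJ r)
    _ = J ^ (r + b) := (pow_add _ _ _).symm
    _ ≤ J ^ d := Ideal.pow_le_pow_right (by lia)

/-- The ideal `I + X J` of `A[X]`. The `m`-path ideal of a cycle has this form with respect to its
last variable, which is what makes the colon ideals of its powers computable. -/
noncomputable def linearExtension (I J : Ideal A) : Ideal A[X] :=
  I.map Polynomial.C ⊔ Ideal.span {Polynomial.X} * J.map Polynomial.C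

theorem coeff_mem_of_mem_linearExtension (hIJ : I ≤ J) {f : A[X]} (hf : f ∈ linearExtension I J)
    (a : ℕ) : f.coeff a ∈ I ^ (1 - a) * J ^ min a 1 := by
  obtain ⟨g, hg, q, hq, rfl⟩ := Submodule.mem_sup.1 hf
  obtain ⟨h, hh, rfl⟩ := Ideal.mem_span_singleton_mul.1 hq
  rw [Ideal.mem_map_C_iff] at hg hh
  cases a with
  | zero => simpa using hg 0
  | succ a => simpa [Polynomial.coeff_X_mul] using J.add_mem (hIJ (hg (a + 1))) (hh a)

theorem coeff_mem_of_mem_linearExtension_pow (hIJ : I ≤ J) {t : ℕ} {f : A[X]}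
    (hf : f ∈ linearExtension I J ^ t) (a : ℕ) : f.coeff a ∈ I ^ (t - a) * J ^ min a t := by
  induction t generalizing f a with
  | zero => simp
  | succ t ih =>
    rw [pow_succ] at hf
    induction hf using Submodule.mul_induction_on' with
    | mem_mul_mem g hg h hh =>
      rw [Polynomial.coeff_mul]
      refine Ideal.sum_mem _ fun ⟨i, j⟩ hij => ?_
      rw [Finset.HasAntidiagonal.mem_antidiagonal] at hij
      have hmem := Ideal.mul_mem_mul (ih hg i) (coeff_mem_of_mem_linearExtension hIJ hh j)
      rw [mul_mul_mul_comm, ← pow_add, ← pow_add] at hmem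
      exact pow_mul_pow_le_pow_mul_pow hIJ (by lia) (by lia) hmem
    | add g _ h _ hg hh => exact Polynomial.coeff_add g h a ▸ Ideal.add_mem _ hg hh

theorem monomial_mem_linearExtension_pow {t a : ℕ} {c : A} (hc : c ∈ I ^ (t - a) * J ^ min a t) :
    Polynomial.monomial a c ∈ linearExtension I J ^ t := by
  have hC : Polynomial.C c ∈
      (I.map Polynomial.C) ^ (t - a) * (J.map Polynomial.C) ^ min a t := by
    simpa only [Ideal.map_mul, Ideal.map_pow] using Ideal.mem_map_of_mem Polynomial.C hc
  have hX : (Polynomial.X ^ a : A[X]) ∈ Ideal.span {Polynomial.X} ^ min a t := by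
    rw [Ideal.span_singleton_pow, Ideal.mem_span_singleton]
    exact pow_dvd_pow _ (min_le_left _ _)
  have hle : (I.map Polynomial.C) ^ (t - a) *
        (Ideal.span {Polynomial.X} * J.map Polynomial.C) ^ min a t ≤
      linearExtension I J ^ (t - a) * linearExtension I J ^ min a t :=
    Ideal.mul_mono (Ideal.pow_right_mono le_sup_left _) (Ideal.pow_right_mono le_sup_right _)
  rw [← pow_add, show t - a + min a t = t by lia, mul_pow, mul_left_comm] at hle
  rw [← Polynomial.C_mul_X_pow_eq_monomial, mul_comm]
  exact hle (Ideal.mul_mem_mul hX hC)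

theorem mem_linearExtension_pow_iff (hIJ : I ≤ J) {t : ℕ} {f : A[X]} :
    f ∈ linearExtension I J ^ t ↔ ∀ a, f.coeff a ∈ I ^ (t - a) * J ^ min a t := by
  refine ⟨coeff_mem_of_mem_linearExtension_pow hIJ, fun hf => ?_⟩
  rw [f.as_sum_support]
  exact Ideal.sum_mem _ fun a _ => monomial_mem_linearExtension_pow (hf a)

/-- The ideal `((I + X J) ^ t : X ^ k)` of `A[X]`. -/
noncomputable def linearExtensionColon (I J : Ideal A) (t k : ℕ) : Ideal A[X] :=
  (linearExtension I J ^ t).colon {Polynomial.X ^ k}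

theorem linearExtensionColon_colon_X (I J : Ideal A) (t k : ℕ) :
    (linearExtensionColon I J t k).colon {Polynomial.X} = linearExtensionColon I J t (k + 1) :=
  colon_pow_colon _ _ k

theorem mem_linearExtensionColon_iff (hIJ : I ≤ J) {t k : ℕ} {f : A[X]} :
    f ∈ linearExtensionColon I J t k ↔
      ∀ a, f.coeff a ∈ I ^ (t - (a + k)) * J ^ min (a + k) t := by
  rw [linearExtensionColon, Submodule.mem_colon_singleton, smul_eq_mul,
    mem_linearExtension_pow_iff hIJ]
  constructor
  · intro h a
    simpa [Polynomial.coeff_mul_X_pow] using h (a + k)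
  · intro h a
    rw [Polynomial.coeff_mul_X_pow']
    split_ifs with hka
    · simpa [Nat.sub_add_cancel hka] using h (a - k)
    · exact Ideal.zero_mem _

theorem isDegreeHomogeneous_linearExtensionColon (hIJ : I ≤ J) (t k : ℕ) :
    IsDegreeHomogeneous (linearExtensionColon I J t k) := by
  intro f hf a
  rw [mem_linearExtensionColon_iff hIJ] at hf ⊢
  intro b
  rw [Polynomial.coeff_monomial]
  split_ifs with h
  · exact h ▸ hf a
  · exact Ideal.zero_mem _

theorem comap_C_linearExtensionColon (hIJ : I ≤ J) {t k : ℕ} (hk : k ≤ t) :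
    (linearExtensionColon I J t k).comap Polynomial.C = I ^ (t - k) * J ^ k := by
  ext c
  rw [Ideal.mem_comap, mem_linearExtensionColon_iff hIJ]
  constructor
  · intro h
    simpa [hk] using h 0
  · intro h a
    rw [Polynomial.coeff_C]
    split_ifs with ha
    · simpa [ha, hk] using h
    · exact Ideal.zero_mem _

theorem pow_mul_pow_le {I₀ : Ideal A} (hI : I ≤ I₀) (hJ : J ≤ I₀) {a b : ℕ} (hab : a + b ≠ 0) :
    I ^ a * J ^ b ≤ I₀ :=
  calc I ^ a * J ^ b ≤ I₀ ^ a * I₀ ^ b :=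
        Ideal.mul_mono (Ideal.pow_right_mono hI a) (Ideal.pow_right_mono hJ b)
    _ = I₀ ^ (a + b) := (pow_add _ _ _).symm
    _ ≤ I₀ := Ideal.pow_le_self hab

theorem comap_C_linearExtensionColon_le (hIJ : I ≤ J) {I₀ : Ideal A} (hJ : J ≤ I₀) {t k : ℕ}
    (hk : k ≤ t) (ht : t ≠ 0) : (linearExtensionColon I J t k).comap Polynomial.C ≤ I₀ := by
  rw [comap_C_linearExtensionColon hIJ hk]
  exact pow_mul_pow_le (hIJ.trans hJ) hJ (by lia)

end LinearExtension

section SplitVar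

open scoped Polynomial

variable {σ τ K : Type*} [Field K] (e : Option τ ≃ σ)

/-- The isomorphism `K[x_i : i ∈ σ] ≃ K[x_j : j ∈ τ][X]` that singles out the variable `e none`. -/
noncomputable def splitVar : MvPolynomial σ K ≃ₐ[K] (MvPolynomial τ K)[X] :=
  (renameEquiv K e.symm).trans (optionEquivLeft K τ)

@[simp]
theorem splitVar_X_none : splitVar e (X (e none) : MvPolynomial σ K) = Polynomial.X := by
  simp [splitVar]

@[simp]
theorem splitVar_rename (p : MvPolynomial τ K) :
    splitVar e (rename (e ∘ some) p) = Polynomial.C p := by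
  induction p using MvPolynomial.induction_on with
  | C a => simp [splitVar]
  | add p q hp hq => simp only [map_add, hp, hq]
  | mul_X p i hp =>
    have hX : splitVar e (X (e (some i)) : MvPolynomial σ K) = Polynomial.C (X i) := by
      simp [splitVar]
    rw [map_mul, map_mul, hp, rename_X, Function.comp_apply, hX, map_mul]

theorem map_splitVar_map_rename (I : Ideal (MvPolynomial τ K)) :
    (I.map (rename (e ∘ some) : MvPolynomial τ K →ₐ[K] MvPolynomial σ K)).map (splitVar e) =
      I.map Polynomial.C :=
  (Ideal.map_mapₐ (rename (e ∘ some)) (splitVar e).toAlgHom).trans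
    (congrArg Ideal.span (Set.image_congr fun p _ => splitVar_rename e p))

theorem map_splitVar_span_X_none :
    (Ideal.span {(X (e none) : MvPolynomial σ K)}).map (splitVar e) =
      Ideal.span {Polynomial.X} := by
  rw [Ideal.map_span, Set.image_singleton, splitVar_X_none]

theorem map_splitVar_idealOfVars :
    (idealOfVars σ K).map (splitVar e) =
      (idealOfVars τ K).map Polynomial.C ⊔ Ideal.span {Polynomial.X} := by
  have hrange : Set.range (X : σ → MvPolynomial σ K) =
      rename (e ∘ some) '' Set.range X ∪ {X (e none)} := by
    rw [← Set.range_comp]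
    ext p
    simp [e.surjective.exists, Option.exists, eq_comm]
  rw [idealOfVars, hrange, Ideal.span_union, Ideal.map_sup, map_splitVar_span_X_none,
    ← Ideal.map_span, map_splitVar_map_rename, idealOfVars]

theorem quotDepth_comap_splitVar (P : Ideal (MvPolynomial τ K)[X]) :
    quotDepth (P.comap (splitVar e)) =
      gradedDepth ((idealOfVars τ K).map Polynomial.C ⊔ Ideal.span {Polynomial.X})
        ((MvPolynomial τ K)[X] ⧸ P) := by
  rw [quotDepth, ← map_splitVar_idealOfVars e]
  exact gradedDepth_quotient_comap (ψ := RingHomClass.toRingHom (splitVar e))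
    (splitVar e).surjective _ P

/-- The ideal `I + x J` of `K[x_i : i ∈ σ]`. -/
noncomputable def varExtension (I J : Ideal (MvPolynomial τ K)) : Ideal (MvPolynomial σ K) :=
  I.map (rename (e ∘ some)) ⊔ Ideal.span {X (e none)} * J.map (rename (e ∘ some))

/-- The ideal `((I + x J) ^ t : x ^ k)` of `K[x_i : i ∈ σ]`. -/
noncomputable def varExtensionColon (I J : Ideal (MvPolynomial τ K)) (t k : ℕ) :
    Ideal (MvPolynomial σ K) :=
  (varExtension e I J ^ t).colon {X (e none) ^ k}

theorem varExtensionColon_colon_X (I J : Ideal (MvPolynomial τ K)) (t k : ℕ) :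
    (varExtensionColon e I J t k).colon {(X (e none) : MvPolynomial σ K)} =
      varExtensionColon e I J t (k + 1) :=
  colon_pow_colon _ _ k

theorem varExtensionColon_eq_comap_splitVar (I J : Ideal (MvPolynomial τ K)) (t k : ℕ) :
    varExtensionColon e I J t k = (linearExtensionColon I J t k).comap (splitVar e) := by
  have h : linearExtension I J = (varExtension e I J).map (splitVar e) := by
    rw [linearExtension, varExtension, Ideal.map_sup, Ideal.map_mul, map_splitVar_span_X_none,
      map_splitVar_map_rename, map_splitVar_map_rename]
  ext p
  rw [Ideal.mem_comap, varExtensionColon, linearExtensionColon, Submodule.mem_colon_singleton,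
    Submodule.mem_colon_singleton, h, ← Ideal.map_pow, ← splitVar_X_none e, smul_eq_mul,
    smul_eq_mul, ← map_pow, ← map_mul, ← Ideal.mem_comap, Ideal.comap_map_of_bijective]
  exact (splitVar e).bijective

end SplitVar

section InternalDirectSum

theorem iSupIndep_sumElim {α ι κ : Type*} [CompleteLattice α] [IsModularLattice α]
    {f : ι → α} {g : κ → α} (hf : iSupIndep f) (hg : iSupIndep g)
    (hfg : Disjoint (⨆ i, f i) (⨆ j, g j)) : iSupIndep (Sum.elim f g) := by
  rintro (i | j) <;>
    simp only [iSup_sum, Sum.elim_inl, Sum.elim_inr, ne_eq, Sum.inl.injEq, Sum.inr.injEq,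
      reduceCtorEq, not_false_eq_true, iSup_pos]
  · exact (hf i).disjoint_sup_right_of_disjoint_sup_left <|
      hfg.mono_left <| sup_le (le_iSup f i) (iSup₂_le fun k _ => le_iSup f k)
  · rw [sup_comm]
    exact (hg j).disjoint_sup_right_of_disjoint_sup_left <|
      hfg.symm.mono_left <| sup_le (le_iSup g j) (iSup₂_le fun k _ => le_iSup g k)

variable {K M M₁ M₂ ι κ : Type*} [Ring K] [AddCommGroup M] [Module K M] [AddCommGroup M₁]
  [Module K M₁] [AddCommGroup M₂] [Module K M₂] [DecidableEq ι] [DecidableEq κ]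

theorem isInternal_comp_equiv {f : κ → Submodule K M} (hf : DirectSum.IsInternal f) (e : ι ≃ κ) :
    DirectSum.IsInternal (f ∘ e) := by
  rw [DirectSum.isInternal_submodule_iff_iSupIndep_and_iSup_eq_top] at hf ⊢
  exact ⟨hf.1.comp e.injective, e.iSup_comp.trans hf.2⟩

theorem isInternal_sum_of_map_eq {f : ι → Submodule K M₁} {g : κ → Submodule K M₂}
    {h : ι ⊕ κ → Submodule K M} (hf : DirectSum.IsInternal f) (hg : DirectSum.IsInternal g)
    {α : M₁ →ₗ[K] M} {β : M₂ →ₗ[K] M} (hα : Function.Injective α) (hβ : Function.Injective β)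
    (hcompl : IsCompl (LinearMap.range α) (LinearMap.range β))
    (hhf : ∀ i, (f i).map α = h (Sum.inl i)) (hhg : ∀ j, (g j).map β = h (Sum.inr j)) :
    DirectSum.IsInternal h := by
  obtain rfl : Sum.elim (fun i => (f i).map α) (fun j => (g j).map β) = h :=
    funext (Sum.rec hhf hhg)
  rw [DirectSum.isInternal_submodule_iff_iSupIndep_and_iSup_eq_top] at *
  have iSup_map_f : ⨆ i, (f i).map α = LinearMap.range α := by
    rw [← Submodule.map_iSup, hf.2, Submodule.map_top]
  have iSup_map_g : ⨆ j, (g j).map β = LinearMap.range β := by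
    rw [← Submodule.map_iSup, hg.2, Submodule.map_top]
  constructor
  · refine iSupIndep_sumElim (α.iSupIndep_map hα hf.1) (β.iSupIndep_map hβ hg.1) ?_
    rw [iSup_map_f, iSup_map_g]
    exact hcompl.disjoint
  · rw [iSup_sum]
    simp only [Sum.elim_inl, Sum.elim_inr, iSup_map_f, iSup_map_g, hcompl.sup_eq_top]

end InternalDirectSum

section StanleyDepth

variable {σ τ K : Type*} [Field K]

theorem le_quotSdepth {L : Ideal (MvPolynomial σ K)} {ι : Type*} [Finite ι] [DecidableEq ι]
    {u : ι → σ →₀ ℕ} {Z : ι → Finset σ}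
    (free : ∀ i, ∀ f ∈ supported K (Z i : Set σ), monomial (u i) (1 : K) * f ∈ L → f = 0)
    (isInternal : DirectSum.IsInternal fun i => stanleySpace L (u i) (Z i))
    {d : ℕ∞} (hd : ∀ i, d ≤ (Z i).card) : d ≤ quotSdepth L :=
  let e := (Finite.equivFin ι).symm
  le_iSup_of_le
    { r := Nat.card ι
      u := u ∘ e
      Z := Z ∘ e
      free := fun i => free (e i)
      isInternal := isInternal_comp_equiv isInternal e } <|
    le_iInf fun i => hd (e i)

theorem mem_stanleySpace {L : Ideal (MvPolynomial σ K)} {u : σ →₀ ℕ} {Z : Finset σ}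
    {z : MvPolynomial σ K ⧸ L} :
    z ∈ stanleySpace L u Z ↔ ∃ q ∈ supported K (Z : Set σ),
      Ideal.Quotient.mk L (monomial u 1 * q) = z := by
  simp [stanleySpace]

theorem monomial_single_add_mul (i : σ) (u : σ →₀ ℕ) (q : MvPolynomial σ K) :
    monomial (Finsupp.single i 1 + u) (1 : K) * q = X i * (monomial u 1 * q) := by
  rw [X, ← mul_assoc, monomial_mul, one_mul]

theorem map_mulColon_stanleySpace (L : Ideal (MvPolynomial σ K)) (i : σ) (u : σ →₀ ℕ)
    (Z : Finset σ) :
    (stanleySpace (L.colon {X i}) u Z).map ((mulColon L (X i)).restrictScalars K) =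
      stanleySpace L (Finsupp.single i 1 + u) Z := by
  ext z
  simp only [Submodule.mem_map, mem_stanleySpace, monomial_single_add_mul]
  constructor
  · rintro ⟨_, ⟨q, hq, rfl⟩, rfl⟩
    exact ⟨q, hq, rfl⟩
  · rintro ⟨q, hq, rfl⟩
    exact ⟨_, ⟨q, hq, rfl⟩, rfl⟩

theorem supported_map (f : τ ↪ σ) (W : Finset τ) :
    supported K ((W.map f : Finset σ) : Set σ) = (supported K (W : Set τ)).map (rename f) := by
  rw [supported, supported, AlgHom.map_adjoin, Finset.coe_map, Set.image_image, Set.image_image]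
  simp only [rename_X]

/-- The map `S' / (L ∩ S') → S / L` induced by a renaming of variables `S' → S`. -/
noncomputable def renameComap (L : Ideal (MvPolynomial σ K)) (f : τ → σ) :
    (MvPolynomial τ K ⧸ L.comap (rename f : MvPolynomial τ K →ₐ[K] MvPolynomial σ K)) →ₗ[K]
      MvPolynomial σ K ⧸ L :=
  (Ideal.quotientMapₐ L (rename f) le_rfl).toLinearMap

theorem renameComap_injective (L : Ideal (MvPolynomial σ K)) (f : τ → σ) :
    Function.Injective (renameComap L f) :=
  Ideal.quotientMap_injective (f := (rename f : MvPolynomial τ K →ₐ[K] MvPolynomial σ K).toRingHom)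

theorem map_renameComap_stanleySpace (L : Ideal (MvPolynomial σ K)) (f : τ ↪ σ) (v : τ →₀ ℕ)
    (W : Finset τ) :
    (stanleySpace (L.comap (rename f : MvPolynomial τ K →ₐ[K] _)) v W).map (renameComap L f) =
      stanleySpace L (v.mapDomain f) (W.map f) := by
  have map_mk (q : MvPolynomial τ K) : renameComap L f (Ideal.Quotient.mk _ (monomial v 1 * q)) =
      Ideal.Quotient.mk L (monomial (v.mapDomain f) 1 * rename f q) := by
    rw [← rename_monomial, ← map_mul]
    rfl
  ext z
  simp only [Submodule.mem_map, mem_stanleySpace, supported_map, Subalgebra.mem_map]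
  constructor
  · rintro ⟨_, ⟨q, hq, rfl⟩, rfl⟩
    exact ⟨_, ⟨q, hq, rfl⟩, (map_mk q).symm⟩
  · rintro ⟨_, ⟨q, hq, rfl⟩, rfl⟩
    exact ⟨_, ⟨q, hq, rfl⟩, map_mk q⟩

theorem min_quotSdepth_le_of_isCompl {L : Ideal (MvPolynomial σ K)} {i : σ} {f : τ ↪ σ}
    (hcompl : IsCompl (LinearMap.range ((mulColon L (X i)).restrictScalars K))
      (LinearMap.range (renameComap L f))) :
    min (quotSdepth (L.colon {X i}))
      (quotSdepth (L.comap (rename f : MvPolynomial τ K →ₐ[K] MvPolynomial σ K))) ≤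
      quotSdepth L := by
  refine le_of_forall_lt fun c hc => ?_
  obtain ⟨D, hD⟩ := lt_iSup_iff.1 (hc.trans_le (min_le_left _ _))
  obtain ⟨E, hE⟩ := lt_iSup_iff.1 (hc.trans_le (min_le_right _ _))
  refine (lt_min hD hE).trans_le <| le_quotSdepth
    (u := Sum.elim (fun j => Finsupp.single i 1 + D.u j) fun j => (E.u j).mapDomain f)
    (Z := Sum.elim D.Z fun j => (E.Z j).map f) ?free ?isInternal ?card
  case free =>
    rintro (j | j)
    · intro q hq h
      refine D.free j q hq (Submodule.mem_colon_singleton.2 ?_)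
      rwa [Sum.elim_inl, monomial_single_add_mul, mul_comm] at h
    · simp only [Sum.elim_inr, supported_map]
      rintro _ ⟨q, hq, rfl⟩ h
      rw [E.free j q hq, map_zero]
      rw [Ideal.mem_comap, map_mul, rename_monomial]
      exact h
  case isInternal =>
    exact isInternal_sum_of_map_eq D.isInternal E.isInternal (mulColon_injective L (X i))
      (renameComap_injective L f) hcompl (fun _ => map_mulColon_stanleySpace L i _ _)
      fun _ => map_renameComap_stanleySpace L f _ _
  case card =>
    rintro (j | j)
    · exact min_le_of_left_le (iInf_le _ j)
    · simpa using min_le_of_right_le (iInf_le _ j)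

theorem isCompl_range_mulColon_range_renameComap (e : Option τ ≃ σ)
    {P : Ideal (Polynomial (MvPolynomial τ K))} (hP : IsDegreeHomogeneous P) :
    IsCompl
      (LinearMap.range ((mulColon (P.comap (splitVar e)) (X (e none))).restrictScalars K))
      (LinearMap.range (renameComap (P.comap (splitVar e)) (e ∘ some))) := by
  constructor
  · rw [Submodule.disjoint_def]
    rintro _ ⟨s, rfl⟩ ⟨a, ha⟩
    obtain ⟨s, rfl⟩ := Ideal.Quotient.mk_surjective s
    obtain ⟨a, rfl⟩ := Ideal.Quotient.mk_surjective a
    rw [← ha]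
    have hmem : rename (e ∘ some) a - X (e none) * s ∈ P.comap (splitVar e) :=
      Ideal.Quotient.eq.1 ha
    refine Ideal.Quotient.eq_zero_iff_mem.2 ?_
    rw [Ideal.mem_comap, map_sub, map_mul, splitVar_rename, splitVar_X_none] at hmem
    simpa using hP _ hmem 0
  · rw [codisjoint_iff, eq_top_iff]
    rintro z -
    obtain ⟨p, rfl⟩ := Ideal.Quotient.mk_surjective z
    have hp : p = X (e none) * (splitVar e).symm (splitVar e p).divX +
        rename (e ∘ some) ((splitVar e p).coeff 0) := by
      apply (splitVar e).injective
      simp [Polynomial.X_mul_divX_add]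
    rw [hp, map_add]
    exact Submodule.add_mem_sup ⟨Ideal.Quotient.mk _ _, rfl⟩ ⟨Ideal.Quotient.mk _ _, rfl⟩

end StanleyDepth

section VarExtensionColon

variable {σ τ K : Type*} [Field K]

theorem mem_idealOfVars_iff {p : MvPolynomial σ K} : p ∈ idealOfVars σ K ↔ p.coeff 0 = 0 := by
  rw [← pow_one (idealOfVars σ K), mem_pow_idealOfVars_iff']
  simp [Finsupp.degree_eq_zero_iff]

theorem idealOfVars_ne_top (σ K : Type*) [Field K] : idealOfVars σ K ≠ ⊤ := by
  rw [Ne, Ideal.eq_top_iff_one, mem_idealOfVars_iff, coeff_zero_one]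
  exact one_ne_zero

variable (e : Option τ ≃ σ) {I J : Ideal (MvPolynomial τ K)} {t k : ℕ}

theorem quotDepth_varExtensionColon_le [Finite τ] (hIJ : I ≤ J) (hJ : J ≤ idealOfVars τ K)
    (hk : k < t) :
    quotDepth (varExtensionColon e I J t k) ≤ quotDepth (I ^ (t - k) * J ^ k) + 1 := by
  rw [varExtensionColon_eq_comap_splitVar, quotDepth_comap_splitVar,
    ← comap_C_linearExtensionColon hIJ hk.le]
  exact (isDegreeHomogeneous_linearExtensionColon hIJ t k).gradedDepth_le_gradedDepth_comap_add_one
    (idealOfVars_ne_top τ K) (comap_C_linearExtensionColon_le hIJ hJ hk.le hk.ne_bot)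

theorem quotDepth_eq_quotDepth_varExtensionColon [Finite τ] (hIJ : I ≤ J)
    (hJ : J ≤ idealOfVars τ K) (hk : k < t)
    (hlt : quotDepth (varExtensionColon e I J t k) <
      quotDepth (varExtensionColon e I J t (k + 1))) :
    quotDepth (I ^ (t - k) * J ^ k) = quotDepth (varExtensionColon e I J t k) := by
  have hP (k : ℕ) := isDegreeHomogeneous_linearExtensionColon hIJ t k
  simp only [varExtensionColon_eq_comap_splitVar, quotDepth_comap_splitVar] at hlt ⊢
  rw [← comap_C_linearExtensionColon hIJ hk.le, quotDepth, ← (hP k).gradedDepth_sup_span_X]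
  rw [← linearExtensionColon_colon_X] at hlt
  refine gradedDepth_quotient_sup_span_eq_of_lt (map_C_sup_span_X_ne_top (idealOfVars_ne_top τ K))
    ?_ (Ideal.mem_sup_right (Ideal.mem_span_singleton_self _)) hlt
  rw [linearExtensionColon_colon_X]
  exact (hP (k + 1)).le_map_C_sup_span_X
    (comap_C_linearExtensionColon_le hIJ hJ (by lia) hk.ne_bot)

theorem quotSdepth_le_quotSdepth_varExtensionColon (hIJ : I ≤ J) (hk : k ≤ t)
    (hlt : quotSdepth (varExtensionColon e I J t k) <
      quotSdepth (varExtensionColon e I J t (k + 1))) :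
    quotSdepth (I ^ (t - k) * J ^ k) ≤ quotSdepth (varExtensionColon e I J t k) := by
  let f : τ ↪ σ := Function.Embedding.some.trans e.toEmbedding
  have hcomap : (varExtensionColon e I J t k).comap (rename f : MvPolynomial τ K →ₐ[K] _) =
      I ^ (t - k) * J ^ k := by
    rw [varExtensionColon_eq_comap_splitVar, ← comap_C_linearExtensionColon hIJ hk]
    ext p
    exact iff_of_eq <| congrArg (· ∈ linearExtensionColon I J t k) (splitVar_rename e p)
  have hcompl := isCompl_range_mulColon_range_renameComap e
    (isDegreeHomogeneous_linearExtensionColon hIJ t k)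
  rw [← varExtensionColon_eq_comap_splitVar] at hcompl
  have hmin := min_quotSdepth_le_of_isCompl (f := f) hcompl
  rw [varExtensionColon_colon_X, hcomap] at hmin
  exact (min_le_iff.1 hmin).resolve_left hlt.not_ge

theorem proposition3p2_general [Finite τ] (hIJ : I ≤ J) (hJ : J ≤ idealOfVars τ K)
    (hk : 1 ≤ k) (hkt : k ≤ t) :
    quotDepth (varExtensionColon e I J t (k - 1)) ≤
      quotDepth (I ^ (t + 1 - k) * J ^ (k - 1)) + 1 ∧
    (quotDepth (varExtensionColon e I J t (k - 1)) < quotDepth (varExtensionColon e I J t k) →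
      quotDepth (I ^ (t + 1 - k) * J ^ (k - 1)) = quotDepth (varExtensionColon e I J t (k - 1))) ∧
    (quotSdepth (varExtensionColon e I J t (k - 1)) < quotSdepth (varExtensionColon e I J t k) →
      quotSdepth (I ^ (t + 1 - k) * J ^ (k - 1)) ≤
        quotSdepth (varExtensionColon e I J t (k - 1))) := by
  obtain ⟨k, rfl⟩ := Nat.exists_eq_add_of_le' hk
  rw [Nat.add_sub_cancel, Nat.add_sub_add_right]
  exact ⟨quotDepth_varExtensionColon_le e hIJ hJ hkt,
    quotDepth_eq_quotDepth_varExtensionColon e hIJ hJ hkt,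
    quotSdepth_le_quotSdepth_varExtensionColon e hIJ (Nat.le_of_succ_le hkt)⟩

end VarExtensionColon

section PathIdeals

/-- The vertices `1, …, n` of the cycle as those of the path on `n - 1` vertices together with the
vertex `n`. -/
def lastVertexEquiv {n : ℕ} (hn : 0 < n) : Option (Fin (n - 1)) ≃ Fin n :=
  finSuccEquivLast.symm.trans (finCongr (Nat.sub_add_cancel hn))

theorem lastVertexEquiv_comp_some {n : ℕ} (hn : 0 < n) :
    lastVertexEquiv hn ∘ some = Fin.castLE (Nat.sub_le n 1) := by
  ext j
  simp [lastVertexEquiv]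

variable {K : Type*} [Field K] {n m : ℕ}

theorem X_lastVertexEquiv_none (hn : 0 < n) :
    (X (lastVertexEquiv hn none) : MvPolynomial (Fin n) K) = lastVar K n hn :=
  rfl

theorem mem_contractedColon_iff {hn : 0 < n} {p : MvPolynomial (Fin (n - 1)) K} :
    p ∈ contractedColon K n m hn ↔
      rename (Fin.castLE (Nat.sub_le n 1)) p * lastVar K n hn ∈ cyclePathIdeal K n m :=
  Submodule.mem_colon_singleton

theorem cyclePathIdeal_le_idealOfVars_pow : cyclePathIdeal K n m ≤ idealOfVars (Fin n) K ^ m := by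
  refine Ideal.span_le.2 ?_
  rintro _ ⟨i, rfl⟩
  simpa using Ideal.prod_mem_prod (s := Finset.univ) (I := fun _ : Fin m => idealOfVars (Fin n) K)
    fun j _ => Ideal.subset_span (Set.mem_range_self _)

theorem contractedColon_le_idealOfVars (hm : 2 ≤ m) (hn : 0 < n) :
    contractedColon K n m hn ≤ idealOfVars (Fin (n - 1)) K := by
  intro p hp
  have hsq := Ideal.pow_le_pow_right hm
    (cyclePathIdeal_le_idealOfVars_pow (mem_contractedColon_iff.1 hp))
  have hcoeff :=
    (mem_pow_idealOfVars_iff' _ _).1 hsq (Finsupp.single ⟨n - 1, Nat.sub_lt hn one_pos⟩ 1)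
  rw [mem_idealOfVars_iff]
  simpa [lastVar, coeff_mul_X', ← constantCoeff_eq] using hcoeff

theorem rename_castLE_prod_X {i : ℕ} (hn : 0 < n) (hi : i + m ≤ n - 1) :
    rename (Fin.castLE (Nat.sub_le n 1)) (∏ j : Fin m, X ⟨i + j, by lia⟩) =
      (∏ j : Fin m, X ⟨(i + j) % n, Nat.mod_lt _ hn⟩ : MvPolynomial (Fin n) K) := by
  rw [map_prod]
  refine Finset.prod_congr rfl fun j _ => ?_
  rw [rename_X]
  congr 1
  exact Fin.ext (Nat.mod_eq_of_lt (by lia)).symm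

theorem map_rename_pathIdeal_le (hn : 0 < n) :
    (pathIdeal K (n - 1) m).map (rename (Fin.castLE (Nat.sub_le n 1)) :
      MvPolynomial (Fin (n - 1)) K →ₐ[K] MvPolynomial (Fin n) K) ≤ cyclePathIdeal K n m := by
  rw [Ideal.map_le_iff_le_comap, pathIdeal, Ideal.span_le]
  rintro _ ⟨i, hi, rfl⟩
  exact Ideal.subset_span ⟨⟨i, by lia⟩, rename_castLE_prod_X hn hi⟩

theorem pathIdeal_le_contractedColon (hn : 0 < n) :
    pathIdeal K (n - 1) m ≤ contractedColon K n m hn := fun _ hp =>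
  mem_contractedColon_iff.2 <|
    Ideal.mul_mem_right _ _ (map_rename_pathIdeal_le hn (Ideal.mem_map_of_mem _ hp))

theorem exists_rename_castLE_eq_prod_X {ι : Type*} {s : Finset ι} {f : ι → Fin n}
    (hf : ∀ j ∈ s, (f j : ℕ) < n - 1) :
    ∃ p : MvPolynomial (Fin (n - 1)) K,
      rename (Fin.castLE (Nat.sub_le n 1)) p = ∏ j ∈ s, X (f j) :=
  (AlgHom.mem_range _).1 <| Subalgebra.prod_mem _ fun j hj =>
    ⟨X ⟨f j, hf j hj⟩, by simp⟩

theorem exists_forall_ne_mod_lt (hmn : m ≤ n) {i : ℕ} (hi : i < n) (h : n - 1 < i + m) :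
    ∃ j₀ : Fin m, (i + j₀) % n = n - 1 ∧ ∀ j ≠ j₀, (i + j) % n < n - 1 := by
  refine ⟨⟨n - 1 - i, by lia⟩, ?_, fun j hj => ?_⟩
  · rw [Nat.add_sub_cancel' (by lia), Nat.mod_eq_of_lt (by lia)]
  · rw [Ne, Fin.ext_iff] at hj
    rcases lt_or_ge (i + j) n with hlt | hge
    · rw [Nat.mod_eq_of_lt hlt]
      lia
    · rw [Nat.mod_eq_sub_mod hge, Nat.mod_eq_of_lt (by lia)]
      lia

theorem prod_X_mod_mem_varExtension (hmn : m ≤ n) (hn : 0 < n) (i : Fin n) :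
    (∏ j : Fin m, X ⟨(i + j) % n, Nat.mod_lt _ i.pos⟩ : MvPolynomial (Fin n) K) ∈
      varExtension (lastVertexEquiv hn) (pathIdeal K (n - 1) m) (contractedColon K n m hn) := by
  rw [varExtension, lastVertexEquiv_comp_some, X_lastVertexEquiv_none]
  rcases le_or_gt (i + m : ℕ) (n - 1) with h | h
  · rw [← rename_castLE_prod_X hn h]
    exact Ideal.mem_sup_left (Ideal.mem_map_of_mem _ (Ideal.subset_span ⟨i, h, rfl⟩))
  · obtain ⟨j₀, hj₀, hlt⟩ := exists_forall_ne_mod_lt hmn i.isLt h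
    obtain ⟨p, hp⟩ := exists_rename_castLE_eq_prod_X (K := K) (s := Finset.univ.erase j₀)
      (f := fun j : Fin m => ⟨(i + j) % n, Nat.mod_lt _ i.pos⟩)
      fun j hj => hlt j (Finset.ne_of_mem_erase hj)
    have hprod : rename (Fin.castLE (Nat.sub_le n 1)) p * lastVar K n hn =
        ∏ j : Fin m, X ⟨(i + j) % n, Nat.mod_lt _ i.pos⟩ := by
      rw [← Finset.prod_erase_mul _ _ (Finset.mem_univ j₀), hp, lastVar]
      simp only [hj₀]
    have hpJ : p ∈ contractedColon K n m hn := by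
      rw [mem_contractedColon_iff, hprod]
      exact Ideal.subset_span ⟨i, rfl⟩
    rw [← hprod, mul_comm (rename _ p)]
    exact Ideal.mem_sup_right <| Ideal.mul_mem_mul (Ideal.mem_span_singleton_self _)
      (Ideal.mem_map_of_mem _ hpJ)

theorem cyclePathIdeal_eq_varExtension (hmn : m ≤ n) (hn : 0 < n) :
    cyclePathIdeal K n m =
      varExtension (lastVertexEquiv hn) (pathIdeal K (n - 1) m) (contractedColon K n m hn) := by
  apply le_antisymm
  · refine Ideal.span_le.2 ?_
    rintro _ ⟨i, rfl⟩
    exact prod_X_mod_mem_varExtension hmn hn i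
  · rw [varExtension, lastVertexEquiv_comp_some, X_lastVertexEquiv_none]
    refine sup_le (map_rename_pathIdeal_le hn) ?_
    rw [mul_comm, Ideal.mul_le]
    intro q hq x hx
    have hle : (contractedColon K n m hn).map (rename (Fin.castLE (Nat.sub_le n 1)) :
        MvPolynomial (Fin (n - 1)) K →ₐ[K] MvPolynomial (Fin n) K) ≤
        (cyclePathIdeal K n m).colon {lastVar K n hn} := Ideal.map_comap_le
    obtain ⟨y, rfl⟩ := Ideal.mem_span_singleton'.1 hx
    rw [mul_left_comm]
    exact Ideal.mul_mem_left _ _ (Submodule.mem_colon_singleton.1 (hle hq))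

theorem colonIdeal_eq_varExtensionColon (hmn : m ≤ n) (hn : 0 < n) (t k : ℕ) :
    colonIdeal K n m hn t k =
      varExtensionColon (lastVertexEquiv hn) (pathIdeal K (n - 1) m) (contractedColon K n m hn)
        t k := by
  rw [colonIdeal, varExtensionColon, ← cyclePathIdeal_eq_varExtension hmn, X_lastVertexEquiv_none]

end PathIdeals

theorem proposition3p2 (K : Type*) [Field K] (n m : ℕ) (hm : 2 ≤ m) (hmn : m < n) (hn : 0 < n)
    (t k : ℕ) (hk : 1 ≤ k) (hkt : k ≤ t) :
    quotDepth (colonIdeal K n m hn t (k - 1)) ≤ quotDepth (mixedIdeal K n m hn t k) + 1 ∧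
    (quotDepth (colonIdeal K n m hn t (k - 1)) < quotDepth (colonIdeal K n m hn t k) →
      quotDepth (mixedIdeal K n m hn t k) = quotDepth (colonIdeal K n m hn t (k - 1))) ∧
    (quotSdepth (colonIdeal K n m hn t (k - 1)) < quotSdepth (colonIdeal K n m hn t k) →
      quotSdepth (mixedIdeal K n m hn t k) ≤ quotSdepth (colonIdeal K n m hn t (k - 1))) := by
  simp only [colonIdeal_eq_varExtensionColon hmn.le, mixedIdeal]
  exact proposition3p2_general (lastVertexEquiv hn) (pathIdeal_le_contractedColon hn)
    (contractedColon_le_idealOfVars hm hn) hk hkt
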